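/- For a positive integer $l$ let $T_l$ be the rooted complete ternary tree with $l$ layers: each non-leaf node has exactly $3$ children and each root-to-leaf path has exactly $l$ nodes. Let $n=n(l)$ be its number of nodes. The grid of width $w$ and height $h$ has $w$ vertical and $h$ horizontal grid lines, hence $w\cdot h$ grid nodes. A straight-line orthogonal drawing of a tree in this grid maps the tree nodes to distinct grid nodes and each edge to the horizontal or vertical grid segment between the images of its ends, such that two distinct edges have no point in common except a common end. The drawing has the subtree separation property if, whenever the subtrees rooted at two nodes $a$ and $b$ (each consisting of the node and all its descendants) have no node in common, the smallest axis-aligned rectangles containing the drawn nodes of these two subtrees have no grid node in common. For positive integers $l,h$ and an odd positive integer $w$, write $T_l\le(w,h)$ if $T_l$ has a straight-line orthogonal drawing in the grid of width $w$ and height $h$ such that (i) the subtree separation property holds, (ii) the root lies on the middle vertical grid line, and (iii) the vertical ray from the root (the root itself excluded) to the top of the grid meets no node and no edge of the tree. **Theorem.** Let $\delta=0.5667$. Then $n\in\Theta(3^l)$, and if $T_l\le(w,h)$, then $w\cdot h\in\Omega\bigl(n^{2\delta/\log 3}\bigr)$, where $\log$ is the natural logarithm. That is, there is an absolute constant $c>0$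 such that $w\cdot h\ge c\,n^{2\delta/\log 3}$ for all positive integers $l$, $h$ and all odd positive integers $w$ with $T_l\le(w,h)$. Moreover $2\delta/\log 3\ge 1.031$, and consequently $w\cdot h\in\Omega(n^{1.031})$ in the same sense. -/

import Mathlib

namespace TernaryDrawing

/-- The nodes of the rooted complete ternary tree with `l` layers. A node is the list of choices
(most recent choice first) made on the way down from the root, so the root is `[]`, the three
children of `v` are `i :: v` for `i : Fin 3`, and each root-to-leaf path has exactly `l` nodes. -/
abbrev Node (l : ℕ) : Type := {v : List (Fin 3) // v.length < l}

/-- The complete ternary tree with `l` layers, as a graph: each node is joined to its children. -/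
def tree (l : ℕ) : SimpleGraph (Node l) where
  Adj u v := (∃ i : Fin 3, v.1 = i :: u.1) ∨ (∃ i : Fin 3, u.1 = i :: v.1)
  symm := ⟨fun _ _ h => h.symm⟩
  loopless := ⟨fun u h => by
    rcases h with ⟨i, hi⟩ | ⟨i, hi⟩ <;> simpa using congrArg List.length hi⟩

/-- The node set of the subtree rooted at `a`, that is `a` together with all its descendants. -/
def subtree {l : ℕ} (a : Node l) : Set (Node l) := {b | a.1 <:+ b.1}

/-- The grid nodes on the segment from `p` to `q`. It is only used for `p` and `q` on a common
horizontal or vertical grid line. (In general `Set.uIcc p q` is the rectangle with opposite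
corners `p` and `q`.) -/
def gridSegment (p q : ℤ × ℤ) : Set (ℤ × ℤ) := Set.uIcc p q

/-- The grid nodes in the smallest axis-aligned rectangle that contains the set `A`. -/
def boundingRect (A : Set (ℤ × ℤ)) : Set (ℤ × ℤ) :=
  {r | (∃ p ∈ A, p.1 ≤ r.1) ∧ (∃ p ∈ A, r.1 ≤ p.1) ∧
       (∃ p ∈ A, p.2 ≤ r.2) ∧ (∃ p ∈ A, r.2 ≤ p.2)}

/-- A straight-line orthogonal drawing of a graph in the grid with `w` vertical grid lines
`x = 0, …, w - 1` and `h` horizontal grid lines `y = 0, …, h - 1`. Nodes go to distinct grid nodes,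
the ends of each edge lie on a common horizontal or vertical grid line, and two distinct edges
have no point in common except a common end. For segments on grid lines with ends at grid nodes
it suffices to look at the grid nodes that they share. -/
structure Drawing {V : Type*} (G : SimpleGraph V) (w h : ℕ) where
  pos : V → ℤ × ℤ
  injective : Function.Injective pos
  inGrid : ∀ v, 0 ≤ (pos v).1 ∧ (pos v).1 < w ∧ 0 ≤ (pos v).2 ∧ (pos v).2 < h
  straight : ∀ u v, G.Adj u v → (pos u).1 = (pos v).1 ∨ (pos u).2 = (pos v).2
  noCrossing : ∀ u v x y, G.Adj u v → G.Adj x y → s(u, v) ≠ s(x, y) →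
    ∀ p ∈ gridSegment (pos u) (pos v) ∩ gridSegment (pos x) (pos y),
      (p = pos u ∨ p = pos v) ∧ (p = pos x ∨ p = pos y)

/-- The subtree separation property: disjoint subtrees have disjoint bounding rectangles. -/
def Drawing.SubtreeSeparated {l w h : ℕ} (D : Drawing (tree l) w h) : Prop :=
  ∀ a b : Node l, Disjoint (subtree a) (subtree b) →
    Disjoint (boundingRect (D.pos '' subtree a)) (boundingRect (D.pos '' subtree b))

/-- The vertical ray going up from the node `r` (with `r` itself left out) to the top of the grid
meets no node and no edge of the graph. -/
def Drawing.RayClear {V : Type*} {G : SimpleGraph V} {w h : ℕ} (D : Drawing G w h) (r : V) : Prop :=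
  ∀ y : ℤ, (D.pos r).2 < y → y < h →
    (∀ v, D.pos v ≠ ((D.pos r).1, y)) ∧
    (∀ u v, G.Adj u v → ((D.pos r).1, y) ∉ gridSegment (D.pos u) (D.pos v))

/-- The relation `T_l ≤ (w, h)`, for positive integers `l`, `h` and an odd positive integer `w`:
the complete ternary tree with `l` layers has a straight-line orthogonal drawing in the grid of
width `w` and height `h` that has the subtree separation property, with the root on the middle
vertical grid line, and with the ray from the root up to the top of the grid clear. -/
def Fits (l w h : ℕ) : Prop :=
  Odd w ∧ 0 < h ∧ ∃ (hl : 0 < l) (D : Drawing (tree l) w h),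
    D.SubtreeSeparated ∧ 2 * (D.pos ⟨[], hl⟩).1 + 1 = w ∧ D.RayClear ⟨[], hl⟩

end TernaryDrawing

namespace TernaryDrawing

/-! Let `x` be the width on one side of the root, including half of the root's column, and `h` the
height. Two potentials, `x * h ^ tilt` and `h * x ^ tilt`, are bounded below together (`Bound`), the
second only up to `ratio`. Each further layer multiplies both bounds by `growth ^ (1 + tilt)`; their
product then bounds the area (`Bound.area`).

Geometrically, the clear ray forces the three children to lie left, right and below. The row of the
root is blocked on both sides and its column above and below, so by `SepDrawing.below` the lower
subtree stays under the row and the left one stays left of the column. Each then has a clear ray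
towards the root (`SepDrawing.rayUp_child`), so induction applies to both, the left one being drawn
sideways. The right child serves only as a blocker.

The bounding boxes of these two subtrees are disjoint: either the left child's box lies wholly to
the left of the lower child's (`Bound.beside`), or wholly above it (`Bound.stack`). Sideways drawing
exchanges width and height, which is why two potentials are needed. The two cases reduce to three
inequalities in `growth`, `tilt` and `ratio`, all of which hold with very little slack. -/

/-! ### Numerical estimates for the constants -/

theorem exp_le_of_taylor {x b : ℝ} (h0 : 0 ≤ x) (h1 : x ≤ 1)
    (hb : (∑ m ∈ Finset.range 12, x ^ m / m.factorial) + x ^ 12 * (12 + 1) /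
      (Nat.factorial 12 * 12) ≤ b) : Real.exp x ≤ b := by
  have := Real.exp_bound' h0 h1 (n := 12) (by norm_num)
  push_cast at this
  exact this.trans hb

theorem le_exp_of_taylor {x b : ℝ} (h0 : 0 ≤ x)
    (hb : b ≤ ∑ m ∈ Finset.range 12, x ^ m / m.factorial) : b ≤ Real.exp x :=
  hb.trans (Real.sum_le_exp_of_nonneg h0 12)

theorem le_exp_neg_of_taylor {x b : ℝ} (h0 : 0 ≤ x) (h1 : x ≤ 1) (hb0 : 0 < b)
    (hb : (∑ m ∈ Finset.range 12, x ^ m / m.factorial) + x ^ 12 * (12 + 1) /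
      (Nat.factorial 12 * 12) ≤ b⁻¹) : b ≤ Real.exp (-x) := by
  rw [Real.exp_neg]
  exact (le_inv_comm₀ hb0 (Real.exp_pos x)).2 (exp_le_of_taylor h0 h1 hb)

/-- The growth factor per layer of both linear dimensions. -/
noncomputable def growth : ℝ := Real.exp 0.5667

/-- The exponent of the narrower dimension in the potentials. -/
noncomputable def tilt : ℝ := 2.02

/-- The ratio of the two potentials. -/
noncomputable def ratio : ℝ := Real.exp (-0.819105)

theorem ratio_pos : 0 < ratio := Real.exp_pos _

theorem ratio_le_one : ratio ≤ 1 := Real.exp_le_one_iff.2 (by norm_num)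

theorem growth_rpow (t : ℝ) : growth ^ t = Real.exp (0.5667 * t) := by
  rw [growth, ← Real.exp_mul]

theorem ratio_rpow (t : ℝ) : ratio ^ t = Real.exp (-0.819105 * t) := by
  rw [ratio, ← Real.exp_mul]

/-- This is what `Bound.stack` needs for the potential `h * x ^ tilt`, which is linear in the
height: `ratio` comes from the lower child, `2` from the two sides of the left child. -/
theorem ratio_mul_growth_le : ratio * growth ^ (1 + tilt) ≤ ratio + 2 := by
  have h1 : Real.exp 0.892329 ≤ 2.440809 :=
    exp_le_of_taylor (by norm_num) (by norm_num) (by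
      norm_num [Finset.sum_range_succ, Nat.factorial])
  have h2 : (0.440820 : ℝ) ≤ Real.exp (-0.819105) :=
    le_exp_neg_of_taylor (by norm_num) (by norm_num) (by norm_num) (by
      norm_num [Finset.sum_range_succ, Nat.factorial])
  rw [growth_rpow, ratio, ← Real.exp_add, tilt]
  norm_num at h1 h2 ⊢
  linarith

/-- This is what `Bound.stack` needs for `x * h ^ tilt`: with the width fixed, the least heights
scale as roots of order `tilt`. -/
theorem growth_rpow_le : growth ^ (1 + 1 / tilt) ≤ 1 + 2 * ratio ^ (1 / tilt) := by
  have h1 : Real.exp 0.847245 ≤ 2.33322 :=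
    exp_le_of_taylor (by norm_num) (by norm_num) (by
      norm_num [Finset.sum_range_succ, Nat.factorial])
  have h2 : (0.666643 : ℝ) ≤ Real.exp (-0.4055) :=
    le_exp_neg_of_taylor (by norm_num) (by norm_num) (by norm_num) (by
      norm_num [Finset.sum_range_succ, Nat.factorial])
  have h3 : Real.exp (0.5667 * (1 + 1 / tilt)) ≤ Real.exp 0.847245 :=
    Real.exp_le_exp.2 (by norm_num [tilt])
  have h4 : Real.exp (-0.4055) ≤ Real.exp (-0.819105 * (1 / tilt)) :=
    Real.exp_le_exp.2 (by norm_num [tilt])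
  rw [growth_rpow, ratio_rpow]
  linarith

/-- This is the Hölder-type condition behind `Bound.beside`, where both dimensions add up. -/
theorem growth_le : growth ≤ 1 + ratio ^ (1 / (1 + tilt)) := by
  have h1 : Real.exp 0.5667 ≤ 1.7624415 :=
    exp_le_of_taylor (by norm_num) (by norm_num) (by
      norm_num [Finset.sum_range_succ, Nat.factorial])
  have h2 : (0.762442 : ℝ) ≤ Real.exp (-0.271227) :=
    le_exp_neg_of_taylor (by norm_num) (by norm_num) (by norm_num) (by
      norm_num [Finset.sum_range_succ, Nat.factorial])
  have h4 : Real.exp (-0.271227) ≤ Real.exp (-0.819105 * (1 / (1 + tilt))) :=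
    Real.exp_le_exp.2 (by norm_num [tilt])
  rw [ratio_rpow, growth]
  linarith

theorem log_three_le : Real.log 3 ≤ 1.0993 := by
  rw [Real.log_le_iff_le_exp (by norm_num)]
  have h1 : (1.73262 : ℝ) ≤ Real.exp 0.54965 :=
    le_exp_of_taylor (by norm_num) (by norm_num [Finset.sum_range_succ, Nat.factorial])
  have h2 : Real.exp 1.0993 = Real.exp 0.54965 * Real.exp 0.54965 := by
    rw [← Real.exp_add]; norm_num
  rw [h2]
  nlinarith

theorem one_lt_growth : 1 < growth := Real.one_lt_exp_iff.2 (by norm_num)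

theorem growth_pos : 0 < growth := Real.exp_pos _

theorem tilt_pos : 0 < tilt := by norm_num [tilt]

/-! ### The two potentials and their growth -/

theorem one_add_sub_mul_le_rpow_neg {u a : ℝ} (hu : 0 < u) (ha : 0 ≤ a) :
    1 + a - a * u ≤ u ^ (-a) := by
  rw [Real.rpow_def_of_pos hu]
  have h1 := Real.add_one_le_exp (Real.log u * -a)
  have h2 := mul_le_mul_of_nonneg_left (Real.log_le_sub_one_of_pos hu) ha
  linarith

theorem growth_sub_one_rpow_le : (growth - 1) ^ (1 + tilt) ≤ ratio := by
  have h : 0 < 1 + tilt := by linarith [tilt_pos]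
  have := Real.rpow_le_rpow (by linarith [one_lt_growth]) (sub_le_iff_le_add'.2 growth_le) h.le
  rwa [← Real.rpow_mul ratio_pos.le, one_div, inv_mul_cancel₀ h.ne', Real.rpow_one] at this

/-- A tangent line bound: splitting a sum of the two potentials costs a factor of `growth`
in each dimension. -/
theorem mul_growth_le_add_mul {a b s t C : ℝ} (hs : 0 < s) (ht : 0 < t) (hC : 0 ≤ C)
    (h₁ : C ≤ a * s ^ tilt) (h₂ : ratio * C ≤ b * t ^ tilt) :
    C * growth ^ (1 + tilt) ≤ (a + b) * (s + t) ^ tilt := by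
  have hS : 0 < s + t := by positivity
  have hl := one_lt_growth
  have hg := growth_pos
  have hg1 : 0 < growth - 1 := by linarith
  have key : ∀ {e r D k : ℝ}, 0 < r → 0 < k → D ≤ e * r ^ tilt → 0 ≤ D →
      D * (k ^ tilt * (1 + tilt - tilt * (r / (s + t) * k))) ≤ e * (s + t) ^ tilt := by
    intro e r D k hr hk hD hD0
    have h1 := one_add_sub_mul_le_rpow_neg (u := r / (s + t) * k) (by positivity) tilt_pos.le
    have h2 : (r / (s + t) * k) ^ (-tilt) = (s + t) ^ tilt / (r ^ tilt * k ^ tilt) := by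
      rw [Real.rpow_neg (by positivity), Real.mul_rpow (by positivity) hk.le,
        Real.div_rpow hr.le hS.le, div_mul_eq_mul_div, inv_div]
    rw [h2] at h1
    have hr' := Real.rpow_pos_of_pos hr tilt
    have hk' := Real.rpow_pos_of_pos hk tilt
    have hS' := Real.rpow_pos_of_pos hS tilt
    calc _ ≤ D * (k ^ tilt * ((s + t) ^ tilt / (r ^ tilt * k ^ tilt))) := by gcongr
      _ = D / r ^ tilt * (s + t) ^ tilt := by field_simp
      _ ≤ e * (s + t) ^ tilt := by
        gcongr
        exact (div_le_iff₀ hr').2 hD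
  -- With `ratio` weakened to `(growth - 1) ^ (1 + tilt)`, the minimum is at `t / s = growth - 1`.
  -- The values of `k` are the reciprocals of the shares of `s` and `t` there, so the linear terms
  -- of the two tangents cancel.
  have k1 := key hs hg h₁ hC
  have h₂' : C * (growth - 1) ^ (1 + tilt) ≤ b * t ^ tilt := by
    refine le_trans ?_ h₂
    rw [mul_comm ratio]
    exact mul_le_mul_of_nonneg_left growth_sub_one_rpow_le hC
  have k2 := key ht (div_pos hg hg1) h₂' (by positivity)
  rw [Real.rpow_one_add' hg1.le (by linarith [tilt_pos]), Real.div_rpow hg.le hg1.le] at k2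
  have hg1' := Real.rpow_pos_of_pos hg1 tilt
  have e2 : C * ((growth - 1) * (growth - 1) ^ tilt) *
      (growth ^ tilt / (growth - 1) ^ tilt *
        (1 + tilt - tilt * (t / (s + t) * (growth / (growth - 1))))) =
      C * growth ^ tilt * ((1 + tilt) * (growth - 1) - tilt * growth * (t / (s + t))) := by
    field_simp
  rw [e2] at k2
  have e3 : t / (s + t) = 1 - s / (s + t) := by field_simp; ring
  rw [e3] at k2
  rw [Real.rpow_one_add' hg.le (by linarith [tilt_pos])]
  linarith

/-- The two potentials of a drawing of height `h` whose part to one side of the root has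
width `x` are bounded below by (multiples of) `C`. -/
def Bound (C x h : ℝ) : Prop := ratio * C ≤ h * x ^ tilt ∧ C ≤ x * h ^ tilt

theorem Bound.mono {C x h x' h' : ℝ} (H : Bound C x h) (hx : 0 < x) (hh : 0 < h)
    (hxx : x ≤ x') (hhh : h ≤ h') : Bound C x' h' := by
  have := tilt_pos
  have hx' := hx.le.trans hxx
  have hh' := hh.le.trans hhh
  constructor
  · refine H.1.trans ?_
    gcongr
  · refine H.2.trans ?_
    gcongr

/-- Index 1 is the lower child, index 2 the left child, drawn sideways and above the lower box. Its
height `h₂` must fit into the width `x`, and its smaller side `x₂` counts twice towards the height.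
-/
theorem Bound.stack {C x₁ h₁ x₂ h₂ x h : ℝ} (H₁ : Bound C x₁ h₁) (H₂ : Bound C x₂ h₂)
    (hC : 0 < C) (hx₁ : 0 < x₁) (hh₁ : 0 < h₁) (hx₂ : 0 < x₂) (hh₂ : 0 < h₂)
    (h₁x : x₁ ≤ x) (h₂x : h₂ ≤ x) (hh : h₁ + 2 * x₂ ≤ h) :
    Bound (C * growth ^ (1 + tilt)) x h := by
  have hx : 0 < x := hx₁.trans_le h₁x
  have hT := tilt_pos
  have hg := growth_pos
  have hr := ratio_pos
  have G₁ := H₁.mono hx₁ hh₁ h₁x le_rfl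
  have G₂ : C ≤ x₂ * x ^ tilt := H₂.2.trans (by gcongr)
  have G₂' : ratio * C ≤ x * x₂ ^ tilt := H₂.1.trans (by gcongr)
  constructor
  · calc ratio * (C * growth ^ (1 + tilt)) = C * (ratio * growth ^ (1 + tilt)) := by ring
      _ ≤ C * (ratio + 2) := by gcongr; exact ratio_mul_growth_le
      _ ≤ (h₁ + 2 * x₂) * x ^ tilt := by linarith [G₁.1]
      _ ≤ h * x ^ tilt := by gcongr
  · have root : ∀ {y D : ℝ}, 0 < y → 0 ≤ D → D * C ≤ x * y ^ tilt →
        D ^ (1 / tilt) * (C / x) ^ (1 / tilt) ≤ y := by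
      intro y D hy hD hyp
      rw [← Real.mul_rpow hD (by positivity), one_div]
      refine (Real.rpow_inv_le_iff_of_pos (by positivity) hy.le hT).2 ?_
      rw [← mul_div_assoc, div_le_iff₀ hx]
      linarith
    have r₁ := root hh₁ zero_le_one (by simpa using G₁.2)
    have r₂ := root hx₂ hr.le G₂'
    rw [Real.one_rpow, one_mul] at r₁
    have hm : 0 ≤ (C / x) ^ (1 / tilt) := by positivity
    have : growth ^ (1 + 1 / tilt) * (C / x) ^ (1 / tilt) ≤ h := by
      refine (mul_le_mul_of_nonneg_right growth_rpow_le hm).trans ?_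
      linarith
    have := Real.rpow_le_rpow (by positivity) this hT.le
    rw [Real.mul_rpow (by positivity) hm, ← Real.rpow_mul growth_pos.le,
      ← Real.rpow_mul (by positivity), one_div_mul_cancel hT.ne', Real.rpow_one, add_mul,
      one_div_mul_cancel hT.ne', one_mul, add_comm tilt] at this
    calc C * growth ^ (1 + tilt) = x * (growth ^ (1 + tilt) * (C / x)) := by field_simp
      _ ≤ _ := by gcongr

/-- Here the height `h₂` of the sideways child adds to the width, and only its part `x₂` on the
upper side of the root's row adds to the height. -/
theorem Bound.beside {C x₁ h₁ x₂ h₂ x h : ℝ} (H₁ : Bound C x₁ h₁) (H₂ : Bound C x₂ h₂)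
    (hC : 0 < C) (hx₁ : 0 < x₁) (hh₁ : 0 < h₁) (hx₂ : 0 < x₂) (hh₂ : 0 < h₂)
    (hx : x₁ + h₂ ≤ x) (hh : h₁ + x₂ ≤ h) :
    Bound (C * growth ^ (1 + tilt)) x h := by
  have hT := tilt_pos
  have hg := growth_pos
  refine Bound.mono (x := x₁ + h₂) (h := h₁ + x₂) ⟨?_, ?_⟩ (by positivity) (by positivity) hx hh
  -- The children exchange roles here, and the result is better than required by a factor `ratio`.
  · have := mul_growth_le_add_mul hh₂ hx₁ hC.le H₂.2 H₁.1
    rw [add_comm h₁, add_comm x₁]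
    refine le_trans ?_ this
    exact mul_le_of_le_one_left (by positivity) ratio_le_one
  · exact mul_growth_le_add_mul hh₁ hx₂ hC.le H₁.2 H₂.1

/-- The area bound contained in the two potentials. -/
theorem Bound.area {C x h : ℝ} (H : Bound C x h) (hC : 0 < C) (hx : 0 < x) (hh : 0 < h) :
    ratio ^ (1 / (1 + tilt)) * C ^ (2 / (1 + tilt)) ≤ x * h := by
  have hT : 0 < 1 + tilt := by linarith [tilt_pos]
  have hr := ratio_pos
  have h1 : ratio * C * C ≤ (x * h) ^ (1 + tilt) := by
    rw [Real.rpow_one_add' (by positivity) hT.ne', Real.mul_rpow hx.le hh.le]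
    calc ratio * C * C ≤ (h * x ^ tilt) * (x * h ^ tilt) :=
          mul_le_mul H.1 H.2 hC.le (by positivity)
      _ = _ := by ring
  have h2 := (Real.rpow_inv_le_iff_of_pos (by positivity) (by positivity) hT).2 h1
  convert h2 using 1
  rw [mul_assoc, Real.mul_rpow hr.le (by positivity), one_div, ← pow_two, ← Real.rpow_natCast,
    ← Real.rpow_mul hC.le]
  norm_num [div_eq_mul_inv]

/-! ### Drawings on lists, their symmetries and their subtrees -/

/-- The point `r` lies in the smallest rectangle containing `a` and `b`. -/
def OnSeg (a b r : ℤ × ℤ) : Prop :=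
  (min a.1 b.1 ≤ r.1 ∧ r.1 ≤ max a.1 b.1) ∧ min a.2 b.2 ≤ r.2 ∧ r.2 ≤ max a.2 b.2

/-- The point `r` lies in the bounding rectangle of the subtree rooted at `a`. -/
def Spans (l : ℕ) (p : List (Fin 3) → ℤ × ℤ) (a : List (Fin 3)) (r : ℤ × ℤ) : Prop :=
  ((∃ v, (v ++ a).length < l ∧ (p (v ++ a)).1 ≤ r.1) ∧
    ∃ v, (v ++ a).length < l ∧ r.1 ≤ (p (v ++ a)).1) ∧
  (∃ v, (v ++ a).length < l ∧ (p (v ++ a)).2 ≤ r.2) ∧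
    ∃ v, (v ++ a).length < l ∧ r.2 ≤ (p (v ++ a)).2

/-- A subtree separated straight-line orthogonal drawing of the ternary tree with `l` layers
in the integer grid; the values of `p` on lists of length at least `l` are irrelevant. -/
structure SepDrawing (l : ℕ) (p : List (Fin 3) → ℤ × ℤ) : Prop where
  inj : ∀ u v, u.length < l → v.length < l → p u = p v → u = v
  straight : ∀ i u, (i :: u).length < l → (p (i :: u)).1 = (p u).1 ∨ (p (i :: u)).2 = (p u).2
  noCross : ∀ i u j v, (i :: u).length < l → (j :: v).length < l → i :: u ≠ j :: v →
    ∀ r, OnSeg (p (i :: u)) (p u) r → OnSeg (p (j :: v)) (p v) r →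
      (r = p (i :: u) ∨ r = p u) ∧ (r = p (j :: v) ∨ r = p v)
  sep : ∀ a b, a.length < l → b.length < l → ¬ a <:+ b → ¬ b <:+ a →
    ∀ r, Spans l p a r → ¬ Spans l p b r

/-- The upward vertical ray from the root meets no node and no edge. -/
def RayUp (l : ℕ) (p : List (Fin 3) → ℤ × ℤ) : Prop :=
  ∀ y, (p []).2 < y → (∀ v, v.length < l → p v ≠ ((p []).1, y)) ∧
    ∀ i u, (i :: u).length < l → ¬ OnSeg (p (i :: u)) (p u) ((p []).1, y)

variable {l : ℕ} {p : List (Fin 3) → ℤ × ℤ}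

theorem OnSeg.swap {a b r : ℤ × ℤ} (h : OnSeg a b r) : OnSeg a.swap b.swap r.swap :=
  ⟨h.2, h.1⟩

theorem onSeg_swap {a b r : ℤ × ℤ} : OnSeg a.swap b.swap r ↔ OnSeg a b r.swap :=
  ⟨OnSeg.swap, OnSeg.swap⟩

/-- Reflection of the grid in the vertical axis. -/
def flip (a : ℤ × ℤ) : ℤ × ℤ := (-a.1, a.2)

theorem flip_flip (a : ℤ × ℤ) : flip (flip a) = a := by simp [flip]

theorem onSeg_flip {a b r : ℤ × ℤ} : OnSeg (flip a) (flip b) r ↔ OnSeg a b (flip r) := by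
  simp only [OnSeg, flip]; omega

theorem onSeg_left (a b : ℤ × ℤ) : OnSeg a b a := by simp [OnSeg]

theorem onSeg_right (a b : ℤ × ℤ) : OnSeg a b b := by simp [OnSeg]

theorem SepDrawing.swap (D : SepDrawing l p) : SepDrawing l (fun v => (p v).swap) where
  inj u v hu hv h := D.inj u v hu hv (Prod.swap_injective h)
  straight i u h := (D.straight i u h).symm
  noCross i u j v h h' hne r h₁ h₂ := by
    have := D.noCross i u j v h h' hne r.swap (onSeg_swap.1 h₁) (onSeg_swap.1 h₂)
    simpa only [Prod.swap_eq_iff_eq_swap] using this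
  sep a b ha hb hab hba r h₁ h₂ := D.sep a b ha hb hab hba r.swap ⟨h₁.2, h₁.1⟩ ⟨h₂.2, h₂.1⟩

theorem spans_flip {a : List (Fin 3)} {r : ℤ × ℤ} :
    Spans l (fun v => flip (p v)) a r ↔ Spans l p a (flip r) := by
  simp only [Spans, flip, neg_le (a := (p _).1), le_neg (b := (p _).1)]
  tauto

theorem SepDrawing.flip (D : SepDrawing l p) : SepDrawing l (fun v => flip (p v)) where
  inj u v hu hv h := D.inj u v hu hv (by
    simpa only [flip_flip] using congrArg TernaryDrawing.flip h)
  straight i u h := by simpa only [TernaryDrawing.flip, neg_inj] using D.straight i u h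
  noCross i u j v h h' hne r h₁ h₂ := by
    have := D.noCross i u j v h h' hne _ (onSeg_flip.1 h₁) (onSeg_flip.1 h₂)
    have e : ∀ a, TernaryDrawing.flip r = a ↔ r = TernaryDrawing.flip a := fun a =>
      ⟨fun h => by rw [← h, flip_flip], fun h => by rw [h, flip_flip]⟩
    simpa only [e] using this
  sep a b ha hb hab hba r h₁ h₂ :=
    D.sep a b ha hb hab hba _ (spans_flip.1 h₁) (spans_flip.1 h₂)

theorem RayUp.flip (H : RayUp l p) : RayUp l (fun v => flip (p v)) := by
  intro y hy
  have := H y hy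
  refine ⟨fun v hv e => this.1 v hv ?_, fun i u h hs => this.2 i u h ?_⟩
  · simpa [TernaryDrawing.flip, Prod.ext_iff] using e
  · simpa [TernaryDrawing.flip] using onSeg_flip.1 hs

theorem Spans.of_child {i : Fin 3} {a : List (Fin 3)} {r : ℤ × ℤ}
    (h : Spans l (fun v => p (v ++ [i])) a r) : Spans (l + 1) p (a ++ [i]) r := by
  have lift : ∀ P : ℤ × ℤ → Prop, (∃ v, (v ++ a).length < l ∧ P (p (v ++ a ++ [i]))) →
      ∃ v, (v ++ (a ++ [i])).length < l + 1 ∧ P (p (v ++ (a ++ [i]))) := by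
    rintro P ⟨v, hv, hP⟩
    refine ⟨v, ?_, by rwa [← List.append_assoc]⟩
    simp only [List.length_append, List.length_singleton] at hv ⊢
    omega
  exact ⟨⟨lift (fun s => s.1 ≤ r.1) h.1.1, lift (fun s => r.1 ≤ s.1) h.1.2⟩,
    lift (fun s => s.2 ≤ r.2) h.2.1, lift (fun s => r.2 ≤ s.2) h.2.2⟩

theorem append_singleton_suffix {a b : List (Fin 3)} {i : Fin 3}
    (h : a ++ [i] <:+ b ++ [i]) : a <:+ b := by
  obtain ⟨t, ht⟩ := h
  exact ⟨t, List.append_cancel_right (by rwa [List.append_assoc])⟩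

/-- Lists carry the latest choice first, so appending `[i]` at the end moves the root to its child
`i`. -/
theorem SepDrawing.child (D : SepDrawing (l + 1) p) (i : Fin 3) :
    SepDrawing l (fun v => p (v ++ [i])) where
  inj u v hu hv h := List.append_cancel_right (D.inj _ _ (by simpa) (by simpa) h)
  straight j u h := D.straight j (u ++ [i]) (by simpa using h)
  noCross j u k v h h' hne := D.noCross j (u ++ [i]) k (v ++ [i]) (by simpa using h)
    (by simpa using h') (fun e => hne (List.append_cancel_right (bs := [i]) (by simpa using e)))
  sep a b ha hb hab hba r h₁ h₂ := D.sep (a ++ [i]) (b ++ [i]) (by simpa) (by simpa)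
    (fun h => hab (append_singleton_suffix h)) (fun h => hba (append_singleton_suffix h)) r
    h₁.of_child h₂.of_child

/-! ### Geometry around the root -/

/-- An edge that is not incident to an edge at the root has no point in common with it. -/
theorem SepDrawing.not_onSeg_root (D : SepDrawing l p) {i a : Fin 3} {u : List (Fin 3)}
    (h : (i :: u).length < l) (hu : u ≠ []) (hua : u ≠ [a]) {r : ℤ × ℤ}
    (hr : OnSeg (p (i :: u)) (p u) r) : ¬ OnSeg (p [a]) (p []) r := by
  intro hr'
  simp only [List.length_cons] at h
  have hne : i :: u ≠ [a] := by simpa using fun _ => hu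
  obtain ⟨h₁, h₂⟩ := D.noCross i u a [] h (by simp; omega) hne r hr hr'
  rcases h₁ with h₁ | h₁ <;> rcases h₂ with h₂ | h₂
  · exact hne (D.inj _ _ h (by simp; omega) (h₁.symm.trans h₂))
  · exact List.cons_ne_nil _ _ (D.inj _ _ h (by simp; omega) (h₁.symm.trans h₂))
  · exact hua (D.inj _ _ (by omega) (by simp; omega) (h₁.symm.trans h₂))
  · exact hu (D.inj _ _ (by omega) (by simp; omega) (h₁.symm.trans h₂))

theorem not_singleton_suffix {i k : Fin 3} (h : i ≠ k) : ¬ [i] <:+ [k] := by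
  rintro ⟨t, ht⟩
  exact h (by simpa using congrArg List.getLast? ht)

/-- If the row of the root is blocked on both sides, by a child of the root or by being free
of edges, then the subtree of a child below the root stays below the root. -/
theorem SepDrawing.below (D : SepDrawing (l + 1) p) {k : Fin 3}
    (hk₁ : (p [k]).1 = (p []).1) (hk₂ : (p [k]).2 < (p []).2)
    (hl : (∃ i, i ≠ k ∧ (p [i]).2 = (p []).2 ∧ (p [i]).1 < (p []).1) ∨
      ∀ x < (p []).1, ∀ i u, (i :: u).length < l + 1 → ¬ OnSeg (p (i :: u)) (p u) (x, (p []).2))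
    (hr : (∃ i, i ≠ k ∧ (p [i]).2 = (p []).2 ∧ (p []).1 < (p [i]).1) ∨
      ∀ x > (p []).1, ∀ i u, (i :: u).length < l + 1 → ¬ OnSeg (p (i :: u)) (p u) (x, (p []).2))
    (v : List (Fin 3)) (hv : v.length < l) : (p (v ++ [k])).2 < (p []).2 := by
  induction v with
  | nil => exact hk₂
  | cons j v ih =>
    simp only [List.length_cons] at hv
    have ih := ih (by omega)
    by_contra! hc
    simp only [List.cons_append] at hc
    -- The first edge to reach the root's row must be vertical. Its point in that row lies on a root
    -- edge, beyond a child of the root, or in a free part of the row; each is impossible.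
    have hlen : (j :: (v ++ [k])).length < l + 1 := by simpa using hv
    have hx := (D.straight j (v ++ [k]) hlen).resolve_right (by omega)
    have hs : OnSeg (p (j :: (v ++ [k]))) (p (v ++ [k])) ((p (v ++ [k])).1, (p []).2) := by
      simp only [OnSeg]; omega
    have hne : ∀ i, i ≠ k → v ++ [k] ≠ [i] := by
      intro i hi h
      exact hi (by simpa using (congrArg List.getLast? h).symm)
    have hspan : ∀ i, i ≠ k → ((p (v ++ [k])).1 ≤ (p [i]).1 ∧ (p [i]).1 ≤ (p []).1 ∨
        (p []).1 ≤ (p [i]).1 ∧ (p [i]).1 ≤ (p (v ++ [k])).1) → (p [i]).2 = (p []).2 → False := by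
      intro i hi hxi hyi
      have l1 : ([k] : List (Fin 3)).length < l + 1 := by simp; omega
      have l2 : (v ++ [k]).length < l + 1 := by simp; omega
      -- Beyond child `i`, the subtree of `k` would have `p [i]` in its bounding rectangle, contrary
      -- to separation.
      refine D.sep [i] [k] l1 l1 (not_singleton_suffix hi) (not_singleton_suffix hi.symm) (p [i])
        ⟨⟨⟨[], l1, le_rfl⟩, ⟨[], l1, le_rfl⟩⟩, ⟨[], l1, le_rfl⟩, [], l1, le_rfl⟩ ⟨?_, ?_⟩
      · rcases hxi with hxi | hxi
        · exact ⟨⟨v, l2, hxi.1⟩, ⟨[], l1, by simp only [List.nil_append]; omega⟩⟩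
        · exact ⟨⟨[], l1, by simp only [List.nil_append]; omega⟩, ⟨v, l2, hxi.2⟩⟩
      · exact ⟨⟨[], l1, by simp only [List.nil_append]; omega⟩, ⟨j :: v, hlen, by
          simp only [List.cons_append]; omega⟩⟩
    rcases lt_trichotomy (p (v ++ [k])).1 (p []).1 with h | h | h
    · rcases hl with ⟨i, hi, hi₂, hi₁⟩ | hl
      · by_cases hc' : (p [i]).1 ≤ (p (v ++ [k])).1
        · exact D.not_onSeg_root hlen (by simp) (hne i hi) hs (by simp only [OnSeg]; omega)
        · exact hspan i hi (by omega) hi₂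
      · exact hl _ h _ _ hlen hs
    · obtain ⟨i, hi⟩ := exists_ne k
      refine D.not_onSeg_root hlen (by simp) (hne i hi) hs ?_
      rw [h]
      exact onSeg_right _ _
    · rcases hr with ⟨i, hi, hi₂, hi₁⟩ | hr
      · by_cases hc' : (p (v ++ [k])).1 ≤ (p [i]).1
        · exact D.not_onSeg_root hlen (by simp) (hne i hi) hs (by simp only [OnSeg]; omega)
        · exact hspan i hi (by omega) hi₂
      · exact hr _ h _ _ hlen hs

/-- If the subtree of a child straight below the root stays below the root, the ray from this
child to the root and beyond meets no other part of its subtree. -/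
theorem SepDrawing.rayUp_child (D : SepDrawing (l + 1) p) {k : Fin 3}
    (hk₁ : (p [k]).1 = (p []).1) (hb : ∀ v, v.length < l → (p (v ++ [k])).2 < (p []).2) :
    RayUp l (fun v => p (v ++ [k])) := by
  intro y hy
  simp only [List.nil_append] at hy ⊢
  have edge : ∀ i u, (i :: u).length < l →
      ¬ OnSeg (p (i :: u ++ [k])) (p (u ++ [k])) ((p [k]).1, y) := by
    intro i u h hs
    have h1 := hb _ h
    have h2 := hb u (by simp at h; omega)
    have hlen : (i :: (u ++ [k])).length < l + 1 := by simpa using h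
    have hyr : y < (p []).2 := by simp only [OnSeg] at hs; omega
    -- Below the root the ray runs along the edge from `[k]` to the root, which other edges may meet
    -- only at its ends.
    have := (D.noCross i (u ++ [k]) k [] hlen (by simp at h ⊢; omega) (by simp) _ hs
      (by simp only [OnSeg]; omega)).2
    rcases this with h | h <;> · have := congrArg Prod.snd h; simp only at this; omega
  refine ⟨fun v hv e => ?_, edge⟩
  cases v with
  | nil => have := congrArg Prod.snd e; simp only [List.nil_append] at this; omega
  | cons i u => exact edge i u hv (by rw [← e]; exact onSeg_left _ _)

/-- Two distinct children of the root do not lie in the same direction. -/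
theorem SepDrawing.not_onSeg_child (D : SepDrawing (l + 1) p) {i j : Fin 3} (hij : i ≠ j)
    (hl : 0 < l) : ¬ OnSeg (p [i]) (p []) (p [j]) := by
  intro h
  have len : ∀ i : Fin 3, [i].length < l + 1 := by simp; omega
  rcases (D.noCross i [] j [] (len i) (len j) (by simpa) _ h (onSeg_left _ _)).1 with e | e
  · exact hij (by simpa using (D.inj _ _ (len j) (len i) e).symm)
  · exact List.cons_ne_nil _ _ (D.inj _ _ (len j) (by simp) e)

/-- The ray excludes the upward direction, and no two children share a direction, so three children
exhaust the other three. -/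
theorem SepDrawing.children (D : SepDrawing (l + 1) p) (H : RayUp (l + 1) p) (hl : 0 < l) :
    ∃ a b k : Fin 3, a ≠ b ∧ a ≠ k ∧ b ≠ k ∧
      ((p [a]).2 = (p []).2 ∧ (p [a]).1 < (p []).1) ∧
      ((p [b]).2 = (p []).2 ∧ (p []).1 < (p [b]).1) ∧
      (p [k]).1 = (p []).1 ∧ (p [k]).2 < (p []).2 := by
  have len : ∀ i : Fin 3, [i].length < l + 1 := by simp; omega
  have hdir : ∀ i : Fin 3, ∃ d : Fin 3,
      d = 0 ∧ (p [i]).2 = (p []).2 ∧ (p [i]).1 < (p []).1 ∨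
      d = 1 ∧ (p [i]).2 = (p []).2 ∧ (p []).1 < (p [i]).1 ∨
      d = 2 ∧ (p [i]).1 = (p []).1 ∧ (p [i]).2 < (p []).2 := by
    intro i
    have hne : p [i] ≠ p [] := fun e => List.cons_ne_nil _ _ (D.inj _ _ (len i) (by simp) e)
    rw [Ne, Prod.ext_iff] at hne
    rcases D.straight i [] (len i) with h | h
    · have : ¬ (p []).2 < (p [i]).2 := fun hlt =>
        (H _ hlt).1 [i] (len i) (Prod.ext h rfl)
      exact ⟨2, by simp; omega⟩
    · rcases lt_or_gt_of_ne (fun e => hne ⟨e, h⟩) with h' | h'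
      · exact ⟨0, by simp; omega⟩
      · exact ⟨1, by simp; omega⟩
  choose d hd using hdir
  have hinj : Function.Injective d := by
    intro i j hij
    by_contra hne
    have n1 := D.not_onSeg_child hne hl
    have n2 := D.not_onSeg_child (Ne.symm hne) hl
    have h1 := hd i
    have h2 := hd j
    simp only [OnSeg] at n1 n2
    omega
  have hsurj := Finite.injective_iff_surjective.1 hinj
  obtain ⟨a, ha⟩ := hsurj 0
  obtain ⟨b, hb⟩ := hsurj 1
  obtain ⟨k, hk⟩ := hsurj 2
  have h1 := hd a
  have h2 := hd b
  have h3 := hd k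
  rw [ha] at h1
  rw [hb] at h2
  rw [hk] at h3
  simp at h1 h2 h3
  refine ⟨a, b, k, ?_, ?_, ?_, h1, h2, h3⟩ <;> rintro rfl <;> simp_all

/-! ### Bounding boxes and the induction on layers -/

theorem exists_minimal_node (f : List (Fin 3) → ℤ) (hl : 0 < l) :
    ∃ v, v.length < l ∧ ∀ u, u.length < l → f v ≤ f u :=
  Set.exists_min_image {v : List (Fin 3) | v.length < l} f (List.finite_length_lt _ _) ⟨[], hl⟩

theorem exists_maximal_node (f : List (Fin 3) → ℤ) (hl : 0 < l) :
    ∃ v, v.length < l ∧ ∀ u, u.length < l → f u ≤ f v :=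
  Set.exists_max_image {v : List (Fin 3) | v.length < l} f (List.finite_length_lt _ _) ⟨[], hl⟩

/-- The bounding rectangle, with every side attained, of a nonempty drawing. -/
theorem exists_box (p : List (Fin 3) → ℤ × ℤ) (hl : 0 < l) : ∃ L R B T : ℤ,
    (∀ v, v.length < l → (L ≤ (p v).1 ∧ (p v).1 ≤ R) ∧ B ≤ (p v).2 ∧ (p v).2 ≤ T) ∧
    ((∃ v, v.length < l ∧ (p v).1 = L) ∧ ∃ v, v.length < l ∧ (p v).1 = R) ∧
    (∃ v, v.length < l ∧ (p v).2 = B) ∧ ∃ v, v.length < l ∧ (p v).2 = T := by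
  obtain ⟨a, ha, ha'⟩ := exists_minimal_node (fun v => (p v).1) hl
  obtain ⟨b, hb, hb'⟩ := exists_maximal_node (fun v => (p v).1) hl
  obtain ⟨c, hc, hc'⟩ := exists_minimal_node (fun v => (p v).2) hl
  obtain ⟨d, hd, hd'⟩ := exists_maximal_node (fun v => (p v).2) hl
  exact ⟨_, _, _, _, fun v hv => ⟨⟨ha' v hv, hb' v hv⟩, hc' v hv, hd' v hv⟩,
    ⟨⟨a, ha, rfl⟩, b, hb, rfl⟩, ⟨c, hc, rfl⟩, d, hd, rfl⟩

theorem Bound.of_drawing (l : ℕ) : ∀ p : List (Fin 3) → ℤ × ℤ, SepDrawing (l + 1) p →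
    RayUp (l + 1) p → ∀ L B T : ℤ,
    (∀ v, v.length < l + 1 → L ≤ (p v).1 ∧ B ≤ (p v).2 ∧ (p v).2 ≤ T) →
    Bound ((1 / 2 : ℝ) ^ tilt * (growth ^ (1 + tilt)) ^ l)
      ((((p []).1 - L : ℤ) : ℝ) + 1 / 2) (((T - B : ℤ) : ℝ) + 1) := by
  induction l with
  | zero =>
    intro p _ _ L B T hbox
    have hb := hbox [] (by simp)
    refine Bound.mono (x := 1 / 2) (h := 1) ⟨?_, ?_⟩ (by norm_num) one_pos ?_ ?_
    · simpa using mul_le_of_le_one_left (by positivity) ratio_le_one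
    -- A single node has `x ≥ 1 / 2` and `h ≥ 1`; `tilt ≥ 1` makes `(1 / 2) ^ tilt` small enough for
    -- both potentials.
    · have := Real.rpow_le_rpow_of_exponent_ge (x := 1 / 2) (by norm_num) (by norm_num)
        (show (1 : ℝ) ≤ tilt by norm_num [tilt])
      simpa using this
    · have : (0 : ℝ) ≤ (((p []).1 - L : ℤ) : ℝ) := by exact_mod_cast (by omega)
      linarith
    · have : (0 : ℝ) ≤ ((T - B : ℤ) : ℝ) := by exact_mod_cast (by omega)
      linarith
  | succ l ih =>
    intro p D H L B T hbox
    obtain ⟨a, b, k, hab, hak, hbk, ha, hb, hk⟩ := D.children H l.succ_pos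
    have hkb := D.below hk.1 hk.2 (.inl ⟨a, hak, ha⟩) (.inl ⟨b, hbk, hb⟩)
    -- After the swap, the root's column becomes its row: it is blocked on one side by the lower
    -- child and on the other by the clear ray.
    have hleft : ∀ v, v.length < l + 1 → (p (v ++ [a])).1 < (p []).1 :=
      D.swap.below (k := a) ha.1 ha.2 (.inl ⟨k, hak.symm, hk⟩)
        (.inr fun y hy i u hu h => (H y hy).2 i u hu (onSeg_swap.1 h))
    have Rk := D.rayUp_child hk.1 hkb
    have Ra : RayUp (l + 1) (fun v => (p (v ++ [a])).swap) := D.swap.rayUp_child ha.1 hleft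
    obtain ⟨L₁, R₁, B₁, T₁, box₁, ⟨⟨v₁, hv₁, eL₁⟩, w₁, hw₁, eR₁⟩, ⟨s₁, hs₁, eB₁⟩, t₁, ht₁, eT₁⟩ :=
      exists_box (fun v => p (v ++ [k])) l.succ_pos
    obtain ⟨L₂, R₂, B₂, T₂, box₂, ⟨⟨v₂, hv₂, eL₂⟩, w₂, hw₂, eR₂⟩, ⟨s₂, hs₂, eB₂⟩, t₂, ht₂, eT₂⟩ :=
      exists_box (fun v => p (v ++ [a])) l.succ_pos
    have root₁ := box₁ [] l.succ_pos
    have root₂ := box₂ [] l.succ_pos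
    simp only [List.nil_append] at root₁ root₂
    have len : ∀ {v : List (Fin 3)} {i : Fin 3}, v.length < l + 1 →
      (v ++ [i]).length < l + 1 + 1 := by intro v i hv; simpa using hv
    have bL₁ := hbox _ (len (i := k) hv₁)
    have bB₁ := hbox _ (len (i := k) hs₁)
    have bL₂ := hbox _ (len (i := a) hv₂)
    have bB₂ := hbox _ (len (i := a) hs₂)
    have bT₂ := hbox _ (len (i := a) ht₂)
    have kT₁ := hkb t₁ ht₁
    have kR₂ := hleft w₂ hw₂
    have G₁ := ih _ (D.child k) Rk L₁ B₁ T₁ (fun v hv => ⟨(box₁ v hv).1.1, (box₁ v hv).2⟩)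
    have G₂ := ih _ (D.child a).swap Ra B₂ L₂ R₂ (fun v hv => ⟨(box₂ v hv).2.1, (box₂ v hv).1⟩)
    -- The flip measures the left child's extent above the root's row, where `G₂` measures it below.
    have G₃ := ih _ (D.child a).swap.flip Ra.flip (-T₂) L₂ R₂
      (fun v hv => ⟨neg_le_neg (box₂ v hv).2.2, (box₂ v hv).1⟩)
    simp only [List.nil_append, Prod.fst_swap, flip, hk.1, ha.1] at G₁ G₂ G₃
    have hC : (0 : ℝ) < (1 / 2 : ℝ) ^ tilt * (growth ^ (1 + tilt)) ^ l := by
      have := growth_pos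
      positivity
    have pos : ∀ m : ℤ, 0 ≤ m → (0 : ℝ) ≤ (m : ℝ) := fun m hm => by exact_mod_cast hm
    have x₁ := pos ((p []).1 - L₁) (by omega)
    have h₁ := pos (T₁ - B₁) (by omega)
    have h₂ := pos (R₂ - L₂) (by omega)
    have x₂ := pos ((p []).2 - B₂) (by omega)
    have x₃ := pos (T₂ - (p []).2) (by omega)
    rw [pow_succ, ← mul_assoc]
    by_cases hsep : R₂ < L₁
    · have c₁ := pos ((p []).1 - L - ((p []).1 - L₁ + (R₂ - L₂ + 1))) (by omega)
      have c₂ := pos (T - B - (T₁ - B₁ + 1 + (T₂ - (p []).2))) (by omega)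
      push_cast at *
      exact G₁.beside G₃ hC (by linarith) (by linarith) (by linarith) (by linarith)
        (by linarith) (by linarith)
    -- Otherwise the corner `(max L₁ L₂, max B₁ B₂)` would lie in both boxes.
    · have hT : T₁ < B₂ := by
        by_contra hcon
        have l1 : ∀ i : Fin 3, [i].length < l + 1 + 1 := by simp
        refine D.sep [a] [k] (l1 a) (l1 k) (not_singleton_suffix hak)
          (not_singleton_suffix hak.symm) (max L₁ L₂, max B₁ B₂)
          ⟨⟨⟨v₂, len hv₂, ?_⟩, w₂, len hw₂, ?_⟩, ⟨s₂, len hs₂, ?_⟩, t₂, len ht₂, ?_⟩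
          ⟨⟨⟨v₁, len hv₁, ?_⟩, w₁, len hw₁, ?_⟩, ⟨s₁, len hs₁, ?_⟩, t₁, len ht₁, ?_⟩ <;>
          dsimp only at * <;> omega
      have c₁ := pos ((p []).1 - L - ((p []).1 - L₁)) (by omega)
      have c₂ := pos ((p []).1 - L - (R₂ - L₂ + 1)) (by omega)
      -- The left box has vertical extent at least twice its smaller side, measured from the root's
      -- row.
      rcases le_total ((p []).2 - B₂) (T₂ - (p []).2) with hm | hm
      · have c₃ := pos (T - B - (T₁ - B₁ + 2 * ((p []).2 - B₂) + 1)) (by omega)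
        push_cast at *
        exact G₁.stack G₂ hC (by linarith) (by linarith) (by linarith) (by linarith)
          (by linarith) (by linarith) (by linarith)
      · have c₃ := pos (T - B - (T₁ - B₁ + 2 * (T₂ - (p []).2) + 1)) (by omega)
        push_cast at *
        exact G₁.stack G₃ hC (by linarith) (by linarith) (by linarith) (by linarith)
          (by linarith) (by linarith) (by linarith)

/-! ### From `Drawing` to `SepDrawing` -/

section Conversion

variable {l w h : ℕ}

/-- The node positions of a drawing, extended arbitrarily to all lists. -/
def Drawing.ext (D : Drawing (tree l) w h) (v : List (Fin 3)) : ℤ × ℤ :=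
  if hv : v.length < l then D.pos ⟨v, hv⟩ else 0

theorem Drawing.ext_eq (D : Drawing (tree l) w h) {v : List (Fin 3)} (hv : v.length < l) :
    D.ext v = D.pos ⟨v, hv⟩ := dif_pos hv

theorem mem_gridSegment {a b r : ℤ × ℤ} : r ∈ gridSegment a b ↔ OnSeg a b r := by
  simp only [gridSegment, Set.uIcc, Set.mem_Icc, Prod.le_def, Prod.fst_inf, Prod.snd_inf,
    Prod.fst_sup, Prod.snd_sup, OnSeg]
  tauto

theorem tree_adj_cons {i : Fin 3} {u : List (Fin 3)} (hu : (i :: u).length < l) :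
    (tree l).Adj ⟨i :: u, hu⟩ ⟨u, (Nat.lt_succ_self _).trans hu⟩ :=
  .inr ⟨i, rfl⟩

theorem Drawing.boundingRect_of_spans (D : Drawing (tree l) w h) {a : List (Fin 3)}
    (ha : a.length < l) {r : ℤ × ℤ} (hr : Spans l D.ext a r) :
    r ∈ boundingRect (D.pos '' subtree ⟨a, ha⟩) := by
  have lift : ∀ P : ℤ × ℤ → Prop, (∃ v, (v ++ a).length < l ∧ P (D.ext (v ++ a))) →
      ∃ q ∈ D.pos '' subtree ⟨a, ha⟩, P q := by
    rintro P ⟨v, hv, hP⟩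
    rw [D.ext_eq hv] at hP
    exact ⟨_, ⟨⟨v ++ a, hv⟩, ⟨v, rfl⟩, rfl⟩, hP⟩
  exact ⟨lift (fun s => s.1 ≤ r.1) hr.1.1, lift (fun s => r.1 ≤ s.1) hr.1.2,
    lift (fun s => s.2 ≤ r.2) hr.2.1, lift (fun s => r.2 ≤ s.2) hr.2.2⟩

theorem Drawing.sepDrawing_ext (D : Drawing (tree l) w h) (hD : D.SubtreeSeparated) :
    SepDrawing l D.ext where
  inj u v hu hv e := by
    rw [D.ext_eq hu, D.ext_eq hv] at e
    exact congrArg Subtype.val (D.injective e)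
  straight i u hu := by
    rw [D.ext_eq hu, D.ext_eq ((Nat.lt_succ_self _).trans hu)]
    exact D.straight _ _ (tree_adj_cons hu)
  noCross i u j v hu hv hne r h₁ h₂ := by
    rw [D.ext_eq hu, D.ext_eq ((Nat.lt_succ_self _).trans hu)] at h₁ ⊢
    rw [D.ext_eq hv, D.ext_eq ((Nat.lt_succ_self _).trans hv)] at h₂ ⊢
    refine D.noCrossing _ _ _ _ (tree_adj_cons hu) (tree_adj_cons hv) ?_ r
      ⟨mem_gridSegment.2 h₁, mem_gridSegment.2 h₂⟩
    rw [Ne, Sym2.eq_iff]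
    rintro (⟨e, -⟩ | ⟨e, e'⟩)
    · exact hne (congrArg Subtype.val e)
    · have e1 := congrArg (fun x => x.1.length) e
      have e2 := congrArg (fun x => x.1.length) e'
      simp only [List.length_cons] at e1 e2
      omega
  sep a b ha hb hab hba r h₁ h₂ := by
    refine Set.disjoint_left.1 (hD ⟨a, ha⟩ ⟨b, hb⟩ (Set.disjoint_left.2 fun v hva hvb => ?_))
      (D.boundingRect_of_spans ha h₁) (D.boundingRect_of_spans hb h₂)
    exact (List.suffix_or_suffix_of_suffix hva hvb).elim hab hba

theorem Drawing.rayUp_ext (D : Drawing (tree l) w h) (hl : 0 < l) (hD : D.RayClear ⟨[], hl⟩) :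
    RayUp l D.ext := by
  intro y hy
  have hl' : ([] : List (Fin 3)).length < l := hl
  rw [D.ext_eq hl'] at hy ⊢
  refine ⟨fun v hv e => ?_, fun i u hu hs => ?_⟩
  · rw [D.ext_eq hv] at e
    have := D.inGrid ⟨v, hv⟩
    rw [e] at this
    exact (hD y hy this.2.2.2).1 _ e
  · rw [D.ext_eq hu, D.ext_eq ((Nat.lt_succ_self _).trans hu)] at hs
    have h₁ := D.inGrid ⟨i :: u, hu⟩
    have h₂ := D.inGrid ⟨u, (Nat.lt_succ_self _).trans hu⟩
    have hyh : y < h := by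
      have := hs.2.2
      dsimp only at this
      omega
    exact (hD y hy hyh).2 _ _ (tree_adj_cons hu) (mem_gridSegment.2 hs)

theorem Fits.bound {l : ℕ} (H : Fits (l + 1) w h) :
    Bound ((1 / 2 : ℝ) ^ tilt * (growth ^ (1 + tilt)) ^ l) (w / 2) h := by
  obtain ⟨-, hh, hl, D, hsep, hmid, hray⟩ := H
  have := Bound.of_drawing l D.ext (D.sepDrawing_ext hsep) (D.rayUp_ext hl hray) 0 0 (h - 1)
    (fun v hv => by
      rw [D.ext_eq hv]
      have := D.inGrid ⟨v, hv⟩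
      omega)
  rw [D.ext_eq (v := []) hl] at this
  have hw : (2 : ℝ) * ((D.pos ⟨[], hl⟩).1 : ℝ) + 1 = w := by exact_mod_cast hmid
  convert this using 1
  · push_cast; linarith
  · push_cast; ring

end Conversion

/-! ### Node count and the final exponent -/

theorem two_mul_card_node (l : ℕ) : 2 * Nat.card (Node l) + 1 = 3 ^ l := by
  induction l with
  | zero =>
    have : IsEmpty (Node 0) := ⟨fun v => absurd v.2 (Nat.not_lt_zero _)⟩
    simp
  | succ l ih =>
    have : Finite (Node l) := (List.finite_length_lt (Fin 3) l).to_subtype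
    let e : Node (l + 1) ≃ Option (Fin 3 × Node l) :=
      { toFun := fun v => match v with
          | ⟨[], _⟩ => none
          | ⟨i :: u, h⟩ => some (i, ⟨u, Nat.lt_of_succ_lt_succ h⟩)
        invFun := fun o => match o with
          | none => ⟨[], l.succ_pos⟩
          | some (i, u) => ⟨i :: u.1, Nat.succ_lt_succ u.2⟩
        left_inv := by rintro ⟨_ | ⟨i, u⟩, h⟩ <;> rfl
        right_inv := by rintro (_ | ⟨i, u⟩) <;> rfl }
    rw [Nat.card_congr e, Finite.card_option, Nat.card_prod, Nat.card_eq_fintype_card,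
      Fintype.card_fin, pow_succ]
    omega

theorem card_node_isTheta :
    (fun l : ℕ => (Nat.card (Node l) : ℝ)) =Θ[Filter.atTop] (fun l : ℕ => (3 : ℝ) ^ l) := by
  have h : ∀ l : ℕ, 2 * (Nat.card (Node l) : ℝ) + 1 = 3 ^ l := fun l => by
    exact_mod_cast two_mul_card_node l
  constructor
  · refine Asymptotics.IsBigO.of_bound 1 (.of_forall fun l => ?_)
    have := h l
    rw [Real.norm_of_nonneg (by positivity), Real.norm_of_nonneg (by positivity)]
    linarith [Nat.cast_nonneg (α := ℝ) (Nat.card (Node l))]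
  · refine Asymptotics.IsBigO.of_bound 3 ((Filter.eventually_ge_atTop 1).mono fun l hl => ?_)
    have := h l
    have h3 : (3 : ℝ) ≤ 3 ^ l := le_self_pow₀ (by norm_num) (by omega)
    rw [Real.norm_of_nonneg (by positivity), Real.norm_of_nonneg (by positivity)]
    linarith

theorem Fits.area : ∃ c : ℝ, 0 < c ∧ ∀ l w h : ℕ, Fits l w h →
    c * (Nat.card (Node l) : ℝ) ^ (2 * (0.5667 : ℝ) / Real.log 3) ≤ (w : ℝ) * (h : ℝ) := by
  have hr := ratio_pos
  have hg := growth_pos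
  have hT : 0 < 1 + tilt := by linarith [tilt_pos]
  -- The factor `2` comes from `x = w / 2`; `growth ^ 2` pays for the shift from `l` to `l + 1`
  -- layers.
  refine ⟨2 * (ratio ^ (1 / (1 + tilt)) * ((1 / 2 : ℝ) ^ tilt) ^ (2 / (1 + tilt))) / growth ^ 2,
    by positivity, fun l w h H => ?_⟩
  obtain ⟨l, rfl⟩ : ∃ m, l = m + 1 := ⟨l - 1, by have := H.2.2.1; omega⟩
  have hw : (0 : ℝ) < w := by exact_mod_cast H.1.pos
  have hh : (0 : ℝ) < h := by exact_mod_cast H.2.1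
  have harea := H.bound.area (by positivity) (by positivity) hh
  rw [Real.mul_rpow (by positivity) (by positivity), ← Real.rpow_natCast (growth ^ (1 + tilt)),
    ← Real.rpow_mul hg.le, ← Real.rpow_mul hg.le,
    show (1 + tilt) * (l : ℝ) * (2 / (1 + tilt)) = ((2 * l : ℕ) : ℝ) by
      push_cast; field_simp, Real.rpow_natCast] at harea
  have hcard : (Nat.card (Node (l + 1)) : ℝ) ≤ 3 ^ (l + 1) := by
    have : (2 * (Nat.card (Node (l + 1)) : ℝ) + 1) = 3 ^ (l + 1) := by
      exact_mod_cast two_mul_card_node (l + 1)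
    linarith [Nat.cast_nonneg (α := ℝ) (Nat.card (Node (l + 1)))]
  have hlog : 0 < Real.log 3 := Real.log_pos (by norm_num)
  have hpow : (Nat.card (Node (l + 1)) : ℝ) ^ (2 * (0.5667 : ℝ) / Real.log 3)
      ≤ growth ^ (2 * l) * growth ^ 2 := by
    refine (Real.rpow_le_rpow (Nat.cast_nonneg _) hcard (by positivity)).trans_eq ?_
    rw [← Real.rpow_natCast, ← Real.rpow_mul (by norm_num), ← pow_add,
      Real.rpow_def_of_pos (by norm_num), growth, ← Real.exp_nat_mul]
    congr 1
    push_cast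
    field_simp
  calc _ ≤ 2 * (ratio ^ (1 / (1 + tilt)) * ((1 / 2 : ℝ) ^ tilt) ^ (2 / (1 + tilt))) / growth ^ 2 *
        (growth ^ (2 * l) * growth ^ 2) := by gcongr
    _ = 2 * (ratio ^ (1 / (1 + tilt)) *
        (((1 / 2 : ℝ) ^ tilt) ^ (2 / (1 + tilt)) * growth ^ (2 * l))) := by field_simp
    _ ≤ (w : ℝ) * h := by linarith

theorem exponent_ge : (1.031 : ℝ) ≤ 2 * (0.5667 : ℝ) / Real.log 3 := by
  rw [le_div_iff₀ (Real.log_pos (by norm_num))]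
  linarith [log_three_le]

end TernaryDrawing

theorem mainTheorem1 :
    (fun l : ℕ => (Nat.card (TernaryDrawing.Node l) : ℝ)) =Θ[Filter.atTop]
        (fun l : ℕ => (3 : ℝ) ^ l) ∧
    (∃ c : ℝ, 0 < c ∧ ∀ l w h : ℕ, TernaryDrawing.Fits l w h →
      c * (Nat.card (TernaryDrawing.Node l) : ℝ) ^ (2 * (0.5667 : ℝ) / Real.log 3)
        ≤ (w : ℝ) * (h : ℝ)) ∧
    (1.031 : ℝ) ≤ 2 * (0.5667 : ℝ) / Real.log 3 ∧
    (∃ c : ℝ, 0 < c ∧ ∀ l w h : ℕ, TernaryDrawing.Fits l w h →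
      c * (Nat.card (TernaryDrawing.Node l) : ℝ) ^ (1.031 : ℝ) ≤ (w : ℝ) * (h : ℝ)) := by
  obtain ⟨c, hc, H⟩ := TernaryDrawing.Fits.area
  refine ⟨TernaryDrawing.card_node_isTheta, ⟨c, hc, H⟩, TernaryDrawing.exponent_ge, c, hc,
    fun l w h hf => le_trans ?_ (H l w h hf)⟩
  have hn : (1 : ℝ) ≤ Nat.card (TernaryDrawing.Node l) := by
    have h1 := TernaryDrawing.two_mul_card_node l
    have h2 : 3 ^ 1 ≤ 3 ^ l := Nat.pow_le_pow_right (by norm_num) hf.2.2.1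
    exact_mod_cast (by omega : 1 ≤ Nat.card (TernaryDrawing.Node l))
  gcongr
  · exact TernaryDrawing.exponent_ge
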